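/- Let $p$ be a prime, $n \ge 0$ an integer, and $P$ a finite $p$-group of nilpotence class at most $n(p-1)+1$. Let $\mathcal F$ be a saturated fusion system on $P$ with $O_p(\mathcal F) = 1$. Then $P$ has exponent at most $p^{n^2(p-1)+n}$. Here a category on $P$ is a category $\mathcal F$ whose objects are the subgroups of $P$ and whose morphisms are injective group homomorphisms, such that every morphism is an isomorphism in $\mathcal F$ followed by an inclusion. A subgroup $Q' \le P$ is fully $\mathcal F$-normalized if $|N_P(Q')| \ge |N_P(R)|$ for every $R$ that is $\mathcal F$-isomorphic to $Q'$. For $\varphi : Q \to P$, let $N_\varphi$ be the group of those $x \in N_P(Q)$ for which there is $y \in N_P(\varphi(Q))$ with $\varphi(xzx^{-1}) = y\varphi(z)y^{-1}$ for all $z \in Q$. A category $\mathcal F$ on $P$ is a saturated fusion system if it contains all homomorphisms between subgroups of $P$ that are induced by conjugation by elements of $P$, the group $\mathrm{Aut}_P(P)$ of inner automorphisms is a Sylow $p$-subgroup of $\mathrm{Aut}_{\mathcal F}(P)$, and every isomorphism $\varphi : Q \to Q'$ in $\mathcal F$ with $Q'$ fully $\mathcal F$-normalized extends to a morphism $N_\varphi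 \to P$ in $\mathcal F$. A subgroup $W \le P$ is normal in $\mathcal F$ if $W \trianglelefteq P$ and every morphism $\varphi : R_1 \to R_2$ in $\mathcal F$ extends to a morphism $\tilde\varphi : WR_1 \to WR_2$ in $\mathcal F$ with $\tilde\varphi(W) = W$; and $O_p(\mathcal F)$ is the largest subgroup of $P$ that is normal in $\mathcal F$. -/

import Mathlib

namespace FusionSystems

variable {P : Type*} [Group P]

/-- `ψ : A → B` extends `φ : Q → R`, all four groups being subgroups of `P`. -/
def Extends {Q R A B : Subgroup P} (ψ : A →* B) (φ : Q →* R) : Prop :=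
  ∃ h : Q ≤ A, ∀ z : Q, (ψ (Subgroup.inclusion h z) : P) = (φ z : P)

/-- The homomorphisms `Q → R` induced by conjugation by elements of `P`. -/
def conjHom (Q R : Subgroup P) : Set (Q →* R) :=
  {φ | ∃ g : P, ∀ x : Q, (φ x : P) = g * (x : P) * g⁻¹}

/-- A category on `P`: the objects are the subgroups of `P`, the morphisms are injective group
homomorphisms, and every morphism is an isomorphism of the category followed by an inclusion. -/
structure CategoryOn (P : Type*) [Group P] where
  Hom : (Q R : Subgroup P) → Set (Q →* R)
  id_mem : ∀ Q : Subgroup P, MonoidHom.id Q ∈ Hom Q Q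
  comp_mem : ∀ {Q R S : Subgroup P} (ψ : R →* S) (φ : Q →* R),
    ψ ∈ Hom R S → φ ∈ Hom Q R → ψ.comp φ ∈ Hom Q S
  injective : ∀ {Q R : Subgroup P} (φ : Q →* R), φ ∈ Hom Q R → Function.Injective φ
  factor : ∀ {Q R : Subgroup P} (φ : Q →* R), φ ∈ Hom Q R →
    ∃ (S : Subgroup P) (h : S ≤ R) (ψ : Q ≃* S),
      ψ.toMonoidHom ∈ Hom Q S ∧ ψ.symm.toMonoidHom ∈ Hom S Q ∧
        φ = (Subgroup.inclusion h).comp ψ.toMonoidHom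

/-- For `φ : Q → P`, the subgroup `N_φ` of those `x` in `N_P(Q)` for which some `y` in `N_P(φ(Q))`
satisfies `φ(x z x⁻¹) = y φ(z) y⁻¹` for all `z` in `Q`. -/
def extenderSubgroup {Q : Subgroup P} (φ : Q →* P) : Subgroup P where
  carrier := {x | x ∈ Subgroup.normalizer (Q : Set P) ∧
    ∃ y ∈ Subgroup.normalizer (φ.range : Set P),
      ∀ z w : Q, (w : P) = x * (z : P) * x⁻¹ → φ w = y * φ z * y⁻¹}
  one_mem' := by
    refine ⟨one_mem _, 1, one_mem _, fun z w h => ?_⟩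
    have : w = z := Subtype.ext (by simpa using h)
    simp [this]
  mul_mem' := by
    rintro a b ⟨ha, y, hy, hya⟩ ⟨hb, y', hy', hyb⟩
    refine ⟨mul_mem ha hb, y * y', mul_mem hy hy', fun z w h => ?_⟩
    have hz : b * (z : P) * b⁻¹ ∈ Q := (Subgroup.mem_normalizer_iff.1 hb z).1 z.2
    rw [hya ⟨_, hz⟩ w (by simp [h, mul_assoc]), hyb z ⟨_, hz⟩ rfl]
    simp [mul_assoc]
  inv_mem' := by
    rintro a ⟨ha, y, hy, hya⟩
    refine ⟨inv_mem ha, y⁻¹, inv_mem hy, fun z w h => ?_⟩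
    rw [hya w z (by simp [h, mul_assoc])]
    simp [mul_assoc]

/-- `Aut_P(Q)`: the automorphisms of `Q` induced by conjugation by elements of `P`. -/
def conjAut (Q : Subgroup P) : Subgroup (MulAut Q) where
  carrier := {α | α.toMonoidHom ∈ conjHom Q Q}
  one_mem' := ⟨1, fun x => by simp⟩
  mul_mem' := by
    rintro a b ⟨g, hg⟩ ⟨k, hk⟩
    refine ⟨g * k, fun x => ?_⟩
    have h1 := hg (b x)
    have h2 := hk x
    simp only [MulEquiv.toMonoidHom_eq_coe, MonoidHom.coe_coe] at h1 h2 ⊢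
    rw [MulAut.mul_apply, h1, h2]
    simp [mul_assoc]
  inv_mem' := by
    rintro a ⟨g, hg⟩
    refine ⟨g⁻¹, fun x => ?_⟩
    have h1 := hg (a⁻¹ x)
    simp only [MulEquiv.toMonoidHom_eq_coe, MonoidHom.coe_coe, MulAut.apply_inv_self] at h1 ⊢
    rw [h1]
    simp [mul_assoc]

namespace CategoryOn

variable (F : CategoryOn P)

/-- `φ` is an isomorphism of the category `F`. -/
def IsIso {Q R : Subgroup P} (φ : Q ≃* R) : Prop :=
  φ.toMonoidHom ∈ F.Hom Q R ∧ φ.symm.toMonoidHom ∈ F.Hom R Q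

/-- `Q` and `R` are `F`-isomorphic. -/
def Isomorphic (Q R : Subgroup P) : Prop :=
  ∃ φ : Q ≃* R, F.IsIso φ

/-- `Q` is fully `F`-normalized. -/
def FullyNormalized (Q : Subgroup P) : Prop :=
  ∀ R : Subgroup P, F.Isomorphic Q R →
    Nat.card (Subgroup.normalizer (R : Set P)) ≤ Nat.card (Subgroup.normalizer (Q : Set P))

/-- `Aut_F(Q)`, a group of automorphisms of `Q`. -/
def aut (Q : Subgroup P) : Subgroup (MulAut Q) where
  carrier := {α | α.toMonoidHom ∈ F.Hom Q Q}
  one_mem' := F.id_mem Q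
  mul_mem' := fun {a b} ha hb => F.comp_mem a.toMonoidHom b.toMonoidHom ha hb
  inv_mem' := by
    intro a ha
    obtain ⟨S, h, ψ, -, h2, h3⟩ := F.factor _ ha
    have hS : S = Q := by
      refine le_antisymm h fun x hx => ?_
      have h4 := DFunLike.congr_fun h3 (a⁻¹ ⟨x, hx⟩)
      simp only [MulEquiv.toMonoidHom_eq_coe, MonoidHom.coe_coe, MulAut.apply_inv_self,
        MonoidHom.comp_apply] at h4
      have h5 := congrArg Subtype.val h4
      simp only [Subgroup.coe_inclusion] at h5
      rw [h5]
      exact SetLike.coe_mem _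
    subst hS
    have : a = ψ := MulEquiv.ext fun x => DFunLike.congr_fun h3 x
    subst this
    exact h2

/-- `F` is a saturated fusion system on the `p`-group `P`. -/
structure IsSaturatedFusionSystem (p : ℕ) : Prop where
  conj_mem : ∀ Q R : Subgroup P, conjHom Q R ⊆ F.Hom Q R
  sylow : ∃ S : Sylow p (F.aut ⊤), (S : Subgroup (F.aut ⊤)) = (conjAut ⊤).subgroupOf (F.aut ⊤)
  extension : ∀ (Q R : Subgroup P) (φ : Q ≃* R), F.IsIso φ → F.FullyNormalized R →
    ∃ ψ ∈ F.Hom (extenderSubgroup (R.subtype.comp φ.toMonoidHom)) ⊤, Extends ψ φ.toMonoidHom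

/-- The morphisms `R₁ → R₂` of the normalizer `N_F(W)`, for `R₁, R₂ ≤ N_P(W)`: those `φ` in `F`
with an extension `ψ : W R₁ → W R₂` in `F` such that `ψ(W) = W`. As `R₁` and `R₂` normalize `W`,
the products `W R₁` and `W R₂` are the joins `W ⊔ R₁` and `W ⊔ R₂`. -/
def normalizerHom (W R₁ R₂ : Subgroup P) : Set (R₁ →* R₂) :=
  {φ | φ ∈ F.Hom R₁ R₂ ∧ ∃ ψ ∈ F.Hom (W ⊔ R₁) (W ⊔ R₂), Extends ψ φ ∧
    (W.subgroupOf (W ⊔ R₁)).map ψ = W.subgroupOf (W ⊔ R₂)}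

/-- `W` is normal in `F`: `N_F(W) = F`, that is, `N_P(W) = P` and both categories have the same
morphisms. -/
def IsNormal (W : Subgroup P) : Prop :=
  Subgroup.normalizer (W : Set P) = ⊤ ∧
    ∀ R₁ R₂ : Subgroup P, F.normalizerHom W R₁ R₂ = F.Hom R₁ R₂

/-- `O_p(F)`, the join of all subgroups normal in `F`; for finite `P` it is the largest of them, see
`isGreatest_core`. -/
def core : Subgroup P := sSup {W | F.IsNormal W}

theorem isNormal_bot : F.IsNormal (⊥ : Subgroup P) := by
  refine ⟨Subgroup.normalizer_eq_top_iff.2 inferInstance, fun R₁ R₂ => ?_⟩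
  refine Set.Subset.antisymm (fun φ h => h.1) fun φ hφ => ⟨hφ, ?_⟩
  have key : ∀ A B : Subgroup P, A = R₁ → B = R₂ → ∃ ψ ∈ F.Hom A B, Extends ψ φ ∧
      ((⊥ : Subgroup P).subgroupOf A).map ψ = (⊥ : Subgroup P).subgroupOf B := by
    rintro _ _ rfl rfl
    exact ⟨φ, hφ, ⟨le_rfl, fun z => rfl⟩, by simp⟩
  exact key _ _ (bot_sup_eq _) (bot_sup_eq _)

theorem map_subtype_of_extends {W A B C D : Subgroup P} {φ : A →* B} {ψ : C →* D}
    (hA : W ≤ A) (hB : W ≤ B) (h : Extends ψ φ)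
    (hφ : (W.subgroupOf A).map φ = W.subgroupOf B) :
    (W.subgroupOf C).map (D.subtype.comp ψ) = W := by
  obtain ⟨hAC, h⟩ := h
  apply le_antisymm
  · rintro _ ⟨x, hx, rfl⟩
    have hx' : (x : P) ∈ W := hx
    have h1 : φ ⟨x, hA hx'⟩ ∈ W.subgroupOf B := by
      rw [← hφ]; exact ⟨⟨x, hA hx'⟩, hx', rfl⟩
    have h2 := h ⟨x, hA hx'⟩
    change (ψ x : P) ∈ W
    have h3 : (ψ x : P) = φ ⟨x, hA hx'⟩ := h2
    rw [h3]; exact h1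
  · intro x hx
    have h1 : (⟨x, hB hx⟩ : B) ∈ (W.subgroupOf A).map φ := by rw [hφ]; exact hx
    obtain ⟨y, hy, hyx⟩ := h1
    refine ⟨Subgroup.inclusion hAC y, hy, ?_⟩
    have := h y
    rw [hyx] at this
    exact this

theorem IsNormal.sup {F : CategoryOn P} {W V : Subgroup P} (hW : F.IsNormal W)
    (hV : F.IsNormal V) : F.IsNormal (W ⊔ V) := by
  have hWn : W.Normal := Subgroup.normalizer_eq_top_iff.1 hW.1
  have hVn : V.Normal := Subgroup.normalizer_eq_top_iff.1 hV.1
  refine ⟨Subgroup.normalizer_eq_top_iff.2 inferInstance, fun R₁ R₂ => ?_⟩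
  refine Set.Subset.antisymm (fun φ h => h.1) fun φ hφ => ⟨hφ, ?_⟩
  have h1 := hφ
  rw [← hV.2] at h1
  obtain ⟨-, φ₁, hφ₁, he₁, hm₁⟩ := h1
  have h2 := hφ₁
  rw [← hW.2] at h2
  obtain ⟨-, φ₂, hφ₂, he₂, hm₂⟩ := h2
  have mW := map_subtype_of_extends (ψ := φ₂) le_sup_left le_sup_left ⟨le_rfl, fun z => rfl⟩ hm₂
  have mV := map_subtype_of_extends (ψ := φ₂) le_sup_left le_sup_left he₂ hm₁
  have he : Extends φ₂ φ := by
    obtain ⟨a, ha⟩ := he₁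
    obtain ⟨b, hb⟩ := he₂
    exact ⟨a.trans b, fun z => (hb _).trans (ha z)⟩
  have key : ∀ A B : Subgroup P, A = W ⊔ (V ⊔ R₁) → B = W ⊔ (V ⊔ R₂) → ∃ ψ ∈ F.Hom A B,
      Extends ψ φ ∧ ((W ⊔ V).subgroupOf A).map ψ = (W ⊔ V).subgroupOf B := by
    rintro _ _ rfl rfl
    refine ⟨φ₂, hφ₂, he, ?_⟩
    have l₁ : V ≤ W ⊔ (V ⊔ R₁) := le_sup_left.trans le_sup_right
    have l₂ : V ≤ W ⊔ (V ⊔ R₂) := le_sup_left.trans le_sup_right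
    apply Subgroup.map_injective (Subgroup.subtype_injective (W ⊔ (V ⊔ R₂)))
    rw [Subgroup.map_map, Subgroup.subgroupOf_sup le_sup_left l₁, Subgroup.map_sup, mW, mV,
      Subgroup.subgroupOf_map_subtype]
    exact (inf_eq_left.2 (sup_le le_sup_left l₂)).symm
  exact key _ _ (sup_assoc _ _ _) (sup_assoc _ _ _)

/-- For finite `P`, the subgroup `O_p(F)` is the largest subgroup that is normal in `F`. -/
theorem isGreatest_core [Finite P] : IsGreatest {W | F.IsNormal W} F.core :=
  ⟨SupClosed.sSup_mem (fun _ hW _ hV => hW.sup hV) (Set.toFinite _) F.isNormal_bot subset_rfl,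
    fun _ hW => le_sSup hW⟩

end CategoryOn

end FusionSystems

/-! ### Unipotent elements of order dividing `p`. -/

section Algebra

/-! Let `W` be the group of `p ^ n`-th powers of elements of `Z(P)`. The heart of the proof is that
`W` is normal in `F`. Then `W = 1`, so `Z(P)` has exponent dividing `p ^ n`. Every factor of the
upper central series inherits this bound, and there are at most `n (p - 1) + 1` factors.

Normality of `W` means that each morphism `f : Q → P` extends to `W Q` with `W` preserved
(`extendsPreserving_centerPow`). This goes by induction on the index of `Q`. A suitable isomorphism
onto a fully normalized subgroup extends to `N_P(Q) > Q`, so it suffices to treat an automorphism of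
a fully normalized `Q < P`. If `Z(P)` is not inside `Q`, the automorphism extends to `Q Z(P)`.

Suppose `Z(P) ≤ Q`, and let `M` be the group of automorphisms of `Q` in `F` that fix all `p ^ n`-th
powers in `Z(Q)`; these include `W`. By the Frattini argument the automorphism is `β μ` with `μ` in
`M` and `β` normalizing `Aut_P(Q) ∩ M`. So `β` extends to the group `A` of elements of `N_P(Q)`
acting on `Q` as members of `M`. The class bound gives `A > Q`: some `x` in `N_P(Q)` outside `Q`
acts on `Z(Q)` with order dividing `p`, hence fixes `p ^ n`-th powers
(`conj_pow_eq_of_nilpotencyClass_le`). By induction `β` preserves `W`, and `μ` fixes it.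

The Sylow property used here is assumed for `P` only; `fullyAutomized` derives it for all fully
normalized subgroups. -/

theorem pow_mul_eq_zero_of_one_add_pow_prime {R : Type*} [CommRing R] {p : ℕ} (hp : p.Prime)
    {x : R} {k : ℕ} (h1 : (1 + x) ^ p = 1) (h2 : x ^ (k * (p - 1) + 1) = 0) :
    (p : R) ^ k * x = 0 := by
  -- The binomial formula with the term `p x` split off. Since `(1 + x) ^ p = 1` it reads `x ^ p =
  -- -p u x`, where `u = 1 + x s` is a unit because `x` is nilpotent.
  obtain ⟨s, hs⟩ : ∃ s : R, (x + 1) ^ p = x ^ p + 1 + p * x * (1 + x * s) := by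
    rw [add_pow_prime_eq hp]
    have hIoo : Finset.Ioo 0 p = insert 1 (Finset.Ioo 1 p) := by
      ext i
      have := hp.one_lt
      simp only [Finset.mem_Ioo, Finset.mem_insert]
      omega
    rw [hIoo, Finset.sum_insert (by simp)]
    refine ⟨∑ i ∈ Finset.Ioo 1 p, x ^ (i - 2) * ((p.choose i / p : ℕ) : R), ?_⟩
    rw [Finset.mul_sum]
    refine congrArg₂ _ (by rw [one_pow]) (congrArg₂ _ (mul_one _) (congrArg₂ _ ?_ ?_))
    · simp [Nat.div_self hp.pos]
    · refine Finset.sum_congr rfl fun i hi => ?_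
      have : i - 1 = i - 2 + 1 := by
        have := (Finset.mem_Ioo.1 hi).1
        omega
      rw [this, one_pow, pow_succ]
      ring
  have hu : IsUnit (1 + x * s) := by
    refine IsNilpotent.isUnit_one_add ?_
    exact (Commute.all x s).isNilpotent_mul_right ⟨_, h2⟩
  have hx : x ^ p = -(p * (1 + x * s)) * x := by
    rw [add_comm, h1] at hs
    linear_combination -hs
  -- Each factor `x ^ (p - 1)` acts on `x` as `-p u`. For `j = k` the left side vanishes, and the
  -- unit can be cancelled.
  have key : ∀ j : ℕ, x ^ (j * (p - 1) + 1) = (-(p * (1 + x * s))) ^ j * x := by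
    intro j
    induction j with
    | zero => simp
    | succ j ih =>
      have hexp : (j + 1) * (p - 1) + 1 = j * (p - 1) + p := by
        have := hp.pos
        rw [add_mul, one_mul, add_assoc, Nat.sub_add_cancel this]
      rw [hexp, pow_add, hx, pow_succ (-(p * (1 + x * s)) : R) j]
      rw [pow_succ] at ih
      linear_combination (-(p * (1 + x * s)) : R) * ih
  rw [key, neg_pow, mul_pow] at h2
  have hu' : IsUnit ((-1) ^ k * (1 + x * s) ^ k) := (isUnit_one.neg.pow k).mul (hu.pow k)
  rw [← hu'.mul_right_eq_zero]
  linear_combination h2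

-- Only powers of `x` are involved, so the commutative case, applied in the universal quotient of
-- `ℤ[X]`, transfers by evaluation at `x`.
open Polynomial in
theorem pow_mul_eq_zero_of_one_add_pow_prime' {R : Type*} [Ring R] {p : ℕ} (hp : p.Prime)
    {x : R} {k : ℕ} (h1 : (1 + x) ^ p = 1) (h2 : x ^ (k * (p - 1) + 1) = 0) :
    (p : R) ^ k * x = 0 := by
  set I : Ideal ℤ[X] := Ideal.span {(1 + X) ^ p - 1, X ^ (k * (p - 1) + 1)} with hI
  have hle : I ≤ RingHom.ker (aeval x : ℤ[X] →ₐ[ℤ] R) := by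
    rw [hI, Ideal.span_le]
    rintro f (rfl | rfl)
    · simp [h1]
    · simp [h2]
  have h : (p : ℤ[X] ⧸ I) ^ k * Ideal.Quotient.mk I X = 0 := by
    refine pow_mul_eq_zero_of_one_add_pow_prime hp ?_ ?_
    · rw [← map_one (Ideal.Quotient.mk I), ← map_add, ← map_pow]
      exact Ideal.Quotient.eq.2 (Ideal.subset_span (by simp))
    · rw [← map_pow]
      exact Ideal.Quotient.eq_zero_iff_mem.2 (Ideal.subset_span (by simp))
  have h' : (p : ℤ[X]) ^ k * X ∈ I := by
    rw [← Ideal.Quotient.eq_zero_iff_mem]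
    simpa using h
  simpa [RingHom.mem_ker] using hle h'

end Algebra

/-! ### Upper central series and `p`-power maps. -/

section Central

open scoped commutatorElement IsMulCommutative

variable {G : Type*} [Group G]

/-- Modulo the `i`-th term, `⁅g, h⁆` is central for `g` in the term `i + 2`, so `⁅g ^ m, h⁆` is
congruent to `⁅g, h⁆ ^ m`, which the induction hypothesis puts in the `i`-th term. -/
theorem pow_mem_upperCentralSeries {m : ℕ} (hm : ∀ z ∈ Subgroup.center G, z ^ m = 1) (i : ℕ) :
    ∀ g ∈ Subgroup.upperCentralSeries G (i + 1), g ^ m ∈ Subgroup.upperCentralSeries G i := by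
  induction i with
  | zero =>
    intro g hg
    rw [zero_add, Subgroup.upperCentralSeries_one] at hg
    rw [hm g hg]
    exact one_mem _
  | succ i ih =>
    intro g hg
    rw [Subgroup.mem_upperCentralSeries_succ_iff]
    intro h
    have hgh : ∀ y, ⁅g, y⁆ ∈ Subgroup.upperCentralSeries G (i + 1) :=
      Subgroup.mem_upperCentralSeries_succ_iff.1 hg
    have hc := ih _ (hgh h)
    set N := Subgroup.upperCentralSeries G i
    have key : ∀ j : ℕ, ((⁅g ^ j, h⁆ : G) : G ⧸ N) = ((⁅g, h⁆ ^ j : G) : G ⧸ N) := by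
      intro j
      induction j with
      | zero => simp
      | succ j hj =>
        have hcomm : ((g * ⁅g ^ j, h⁆ : G) : G ⧸ N) = ((⁅g ^ j, h⁆ * g : G) : G ⧸ N) := by
          have h3 : ⁅(⁅g, h⁆ ^ j), g⁆ ∈ N :=
            Subgroup.mem_upperCentralSeries_succ_iff.1 (pow_mem (hgh h) j) g
          have h4 : ((⁅(⁅g, h⁆ ^ j), g⁆ : G) : G ⧸ N) = 1 := (QuotientGroup.eq_one_iff _).2 h3
          rw [QuotientGroup.mk_mul, QuotientGroup.mk_mul, hj]
          have h5 : (((⁅g, h⁆ ^ j : G) : G ⧸ N)) * (g : G ⧸ N) * ((⁅g, h⁆ ^ j : G) : G ⧸ N)⁻¹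
            * (g : G ⧸ N)⁻¹ = 1 := h4
          rw [mul_inv_eq_one, mul_inv_eq_iff_eq_mul] at h5
          exact h5.symm
        have e : ⁅g ^ (j + 1), h⁆ = g * ⁅g ^ j, h⁆ * g⁻¹ * ⁅g, h⁆ := by
          simp only [commutatorElement_def, pow_succ']
          group
        rw [e, QuotientGroup.mk_mul, QuotientGroup.mk_mul, hcomm, ← QuotientGroup.mk_mul,
          mul_inv_cancel_right, hj, ← QuotientGroup.mk_mul, pow_succ]
    rw [← QuotientGroup.eq_one_iff, key]
    exact (QuotientGroup.eq_one_iff _).2 hc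

theorem exponent_dvd_of_center [Group.IsNilpotent G] {m c : ℕ}
    (hm : ∀ z ∈ Subgroup.center G, z ^ m = 1) (hc : Group.nilpotencyClass G ≤ c) :
    Monoid.exponent G ∣ m ^ c := by
  refine Monoid.exponent_dvd_of_forall_pow_eq_one fun g => ?_
  have h : ∀ i, ∀ g ∈ Subgroup.upperCentralSeries G i, g ^ m ^ i = 1 := by
    intro i
    induction i with
    | zero => intro g hg; simpa using hg
    | succ i ih =>
      intro g hg
      rw [pow_succ', pow_mul]
      exact ih _ (pow_mem_upperCentralSeries hm i g hg)
  refine h c g ?_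
  rw [Subgroup.upperCentralSeries_eq_top_iff_nilpotencyClass_le.2 hc]
  trivial

/-- An element `x` acting with order dividing `p` on an abelian subgroup `V` of a group of class at
most `k (p - 1) + 1` centralizes the `p ^ k`-th powers of elements of `V`. -/
theorem conj_pow_eq_of_nilpotencyClass_le [Group.IsNilpotent G] {p k : ℕ} (hp : p.Prime)
    (hc : Group.nilpotencyClass G ≤ k * (p - 1) + 1) (V : Subgroup G) [IsMulCommutative V] {x : G}
    (hx : ∀ v ∈ V, x * v * x⁻¹ ∈ V) (hxp : ∀ v ∈ V, x ^ p * v * (x ^ p)⁻¹ = v)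
    {v : G} (hv : v ∈ V) : x * v ^ p ^ k * x⁻¹ = v ^ p ^ k := by
  let f : AddMonoid.End (Additive V) := MonoidHom.toAdditive
    { toFun := fun v => ⟨x * v * x⁻¹, hx v v.2⟩
      map_one' := by ext; simp
      map_mul' := fun a b => by ext; simp [mul_assoc] }
  have hf : ∀ a : Additive V, (((f a).toMul : V) : G) = x * (a.toMul : V) * x⁻¹ := fun _ => rfl
  have hfpow : ∀ (j : ℕ) (a : Additive V),
      ((((f ^ j) a).toMul : V) : G) = x ^ j * (a.toMul : V) * (x ^ j)⁻¹ := by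
    intro j
    induction j with
    | zero => intro a; simp
    | succ j ih =>
      intro a
      rw [pow_succ, AddMonoid.End.coe_mul, Function.comp_apply, ih, hf, pow_succ]
      group
  have h1 : (1 + (f - 1)) ^ p = 1 := by
    rw [add_sub_cancel]
    refine AddMonoidHom.ext fun a => ?_
    apply Additive.toMul.injective
    apply Subtype.ext
    refine (hfpow p a).trans ?_
    exact hxp _ (Subtype.coe_prop _)
  -- In additive notation `(f - 1) v` is the inverse of the commutator `⁅v, x⁆`, so `f - 1` descends
  -- the upper central series and the class bounds its nilpotency index.
  have hstep : ∀ (i : ℕ) (a : Additive V),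
      ((a.toMul : V) : G) ∈ Subgroup.upperCentralSeries G (i + 1) →
      (((((f - 1) a).toMul : V)) : G) ∈ Subgroup.upperCentralSeries G i := by
    intro i a ha
    have h2 := inv_mem (Subgroup.mem_upperCentralSeries_succ_iff.1 ha x)
    have h3 : (((((f - 1) a).toMul : V)) : G) = ⁅((a.toMul : V) : G), x⁆⁻¹ := by
      have : (f - 1) a = f a - a := rfl
      rw [this, toMul_sub, Subgroup.coe_div, hf, div_eq_mul_inv]
      simp only [commutatorElement_def]
      group
    rw [h3]
    exact h2
  have hiter : ∀ (i : ℕ) (a : Additive V),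
      ((a.toMul : V) : G) ∈ Subgroup.upperCentralSeries G i → ((f - 1) ^ i) a = 0 := by
    intro i
    induction i with
    | zero =>
      intro a ha
      have : ((a.toMul : V) : G) = 1 := by simpa using ha
      apply Additive.toMul.injective
      apply Subtype.ext
      simpa using this
    | succ i ih =>
      intro a ha
      rw [pow_succ, AddMonoid.End.coe_mul, Function.comp_apply]
      exact ih _ (hstep i a ha)
  have h2 : (f - 1) ^ (k * (p - 1) + 1) = 0 := by
    refine AddMonoidHom.ext fun a => hiter _ a ?_
    rw [Subgroup.upperCentralSeries_eq_top_iff_nilpotencyClass_le.2 hc]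
    trivial
  have h3 := pow_mul_eq_zero_of_one_add_pow_prime' hp h1 h2
  have h4 := DFunLike.congr_fun h3 (Additive.ofMul (⟨v, hv⟩ : V))
  have h5 : p ^ k • (f (Additive.ofMul (⟨v, hv⟩ : V)) - Additive.ofMul (⟨v, hv⟩ : V)) = 0 := by
    refine Eq.trans ?_ h4
    rw [← Nat.cast_pow, AddMonoid.End.coe_mul, Function.comp_apply, AddMonoid.End.natCast_apply]
    rfl
  rw [smul_sub, sub_eq_zero] at h5
  have h6 := congrArg (fun a : Additive V => ((a.toMul : V) : G)) h5
  simp only [toMul_nsmul, Subgroup.coe_pow, hf, toMul_ofMul] at h6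
  rw [← conj_pow, h6]

/-- Among the iterated `p`-th powers of an element of the normalizer outside `Q`, the last one
outside `Q` will do. -/
theorem exists_mem_normalizer_pow_mem {p : ℕ} (hG : IsPGroup p G)
    {Q : Subgroup G} (hQ : Q < Subgroup.normalizer (Q : Set G)) :
    ∃ x ∈ Subgroup.normalizer (Q : Set G), x ∉ Q ∧ x ^ p ∈ Q := by
  classical
  obtain ⟨x, hx, hxQ⟩ := SetLike.exists_of_lt hQ
  obtain ⟨j, hj⟩ := hG x
  have hex : ∃ j, x ^ p ^ j ∈ Q := ⟨j, by rw [hj]; exact one_mem _⟩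
  obtain ⟨i, hi⟩ : ∃ i, Nat.find hex = i + 1 := by
    refine Nat.exists_eq_succ_of_ne_zero fun h0 => hxQ ?_
    have := Nat.find_spec hex
    rw [h0] at this
    simpa using this
  refine ⟨x ^ p ^ i, pow_mem hx _, Nat.find_min hex (by omega), ?_⟩
  have := Nat.find_spec hex
  rw [hi, pow_succ, pow_mul] at this
  exact this

end Central

/-! ### Morphisms of `F` as total maps `P → P`, whose values off the source are irrelevant. -/

namespace FusionSystems

namespace CategoryOn

variable {P : Type*} [Group P] {F : CategoryOn P} {p : ℕ} {Q R S N : Subgroup P} {f g : P → P}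

variable (F) in
/-- `f` restricts to a morphism `Q → P` of the category `F`. -/
def IsMor (Q : Subgroup P) (f : P → P) : Prop :=
  ∃ φ ∈ F.Hom Q ⊤, ∀ x : Q, f x = φ x

variable (F) in
/-- `f` restricts to an isomorphism `Q → R` of the category `F`. -/
structure IsIsoOn (Q R : Subgroup P) (f : P → P) : Prop where
  isMor : F.IsMor Q f
  image_eq : f '' Q = R

theorem IsMor.congr (h : F.IsMor Q f) (hfg : ∀ x ∈ Q, g x = f x) : F.IsMor Q g := by
  obtain ⟨φ, hφ, h⟩ := h
  exact ⟨φ, hφ, fun x => (hfg x x.2).trans (h x)⟩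

theorem IsMor.map_mul (h : F.IsMor Q f) {x y : P} (hx : x ∈ Q) (hy : y ∈ Q) :
    f (x * y) = f x * f y := by
  obtain ⟨φ, -, h⟩ := h
  have := h (⟨x, hx⟩ * ⟨y, hy⟩)
  rw [_root_.map_mul, Subgroup.coe_mul, Subgroup.coe_mul, ← h, ← h] at this
  exact this

theorem IsMor.map_one (h : F.IsMor Q f) : f 1 = 1 := by
  have := h.map_mul (one_mem Q) (one_mem Q)
  simpa using this

theorem IsMor.map_inv (h : F.IsMor Q f) {x : P} (hx : x ∈ Q) : f x⁻¹ = (f x)⁻¹ := by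
  rw [eq_inv_iff_mul_eq_one, ← h.map_mul (inv_mem hx) hx, inv_mul_cancel, h.map_one]

theorem IsMor.map_conj (h : F.IsMor Q f) {x y : P} (hx : x ∈ Q) (hy : y ∈ Q) :
    f (x * y * x⁻¹) = f x * f y * (f x)⁻¹ := by
  rw [h.map_mul (mul_mem hx hy) (inv_mem hx), h.map_mul hx hy, h.map_inv hx]

theorem IsMor.map_pow (h : F.IsMor Q f) {x : P} (hx : x ∈ Q) (n : ℕ) : f (x ^ n) = f x ^ n := by
  induction n with
  | zero => simpa using h.map_one
  | succ n ih => rw [pow_succ, h.map_mul (pow_mem hx n) hx, ih, pow_succ]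

theorem IsMor.injOn (h : F.IsMor Q f) : Set.InjOn f Q := by
  obtain ⟨φ, hφ, h⟩ := h
  intro x hx y hy hxy
  have h1 := h ⟨x, hx⟩
  have h2 := h ⟨y, hy⟩
  have := F.injective φ hφ (Subtype.ext (h1.symm.trans (hxy.trans h2)))
  exact congrArg Subtype.val this

theorem IsMor.exists_isIsoOn (h : F.IsMor Q f) : ∃ R, F.IsIsoOn Q R f := by
  refine ⟨h.choose.range.map (Subgroup.subtype ⊤), h, ?_⟩
  have h2 := h.choose_spec.2
  ext y
  constructor
  · rintro ⟨x, hx, rfl⟩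
    exact ⟨_, ⟨⟨x, hx⟩, rfl⟩, (h2 ⟨x, hx⟩).symm⟩
  · rintro ⟨_, ⟨x, rfl⟩, rfl⟩
    exact ⟨x, x.2, h2 x⟩

theorem IsIsoOn.mapsTo (h : F.IsIsoOn Q R f) {x : P} (hx : x ∈ Q) : f x ∈ R := by
  have : f x ∈ f '' Q := ⟨x, hx, rfl⟩
  rw [h.image_eq] at this
  exact this

theorem IsIsoOn.exists_eq (h : F.IsIsoOn Q R f) {y : P} (hy : y ∈ R) : ∃ x ∈ Q, f x = y := by
  have : y ∈ f '' Q := by rw [h.image_eq]; exact hy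
  exact this

theorem IsIsoOn.congr (h : F.IsIsoOn Q R f) (hfg : ∀ x ∈ Q, g x = f x) : F.IsIsoOn Q R g :=
  ⟨h.isMor.congr hfg, by rw [← h.image_eq]; exact Set.image_congr hfg⟩

theorem IsIsoOn.card_eq (h : F.IsIsoOn Q R f) : Nat.card Q = Nat.card R := by
  refine Nat.card_congr (Equiv.ofBijective (fun x : Q => ⟨f x, h.mapsTo x.2⟩) ⟨?_, ?_⟩)
  · intro x y hxy
    exact Subtype.ext (h.isMor.injOn x.2 y.2 (congrArg Subtype.val hxy))
  · rintro ⟨y, hy⟩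
    obtain ⟨x, hx, rfl⟩ := h.exists_eq hy
    exact ⟨⟨x, hx⟩, rfl⟩



namespace IsSaturatedFusionSystem

theorem inclusion_mem (hF : F.IsSaturatedFusionSystem p) (h : Q ≤ R) :
    Subgroup.inclusion h ∈ F.Hom Q R :=
  hF.conj_mem Q R ⟨1, fun x => by simp⟩

theorem isMor_of_mem (hF : F.IsSaturatedFusionSystem p) {φ : Q →* R} (hφ : φ ∈ F.Hom Q R)
    (h : ∀ x : Q, f x = φ x) : F.IsMor Q f :=
  ⟨_, F.comp_mem _ _ (hF.inclusion_mem le_top) hφ, h⟩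

theorem exists_hom (hF : F.IsSaturatedFusionSystem p) (h : F.IsMor Q f)
    (hR : ∀ x ∈ Q, f x ∈ R) : ∃ ψ ∈ F.Hom Q R, ∀ x : Q, (ψ x : P) = f x := by
  obtain ⟨φ, hφ, h⟩ := h
  obtain ⟨S, hS, ψ, h1, -, rfl⟩ := F.factor φ hφ
  have h2 : ∀ x : Q, (ψ x : P) = f x := fun x => (h x).symm
  have hSR : S ≤ R := by
    intro y hy
    have h3 := h2 (ψ.symm ⟨y, hy⟩)
    rw [ψ.apply_symm_apply] at h3
    change y = _ at h3
    rw [h3]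
    exact hR _ (Subtype.coe_prop _)
  exact ⟨_, F.comp_mem _ _ (hF.inclusion_mem hSR) h1, h2⟩

theorem exists_mulEquiv (hF : F.IsSaturatedFusionSystem p) (h : F.IsIsoOn Q R f) :
    ∃ e : Q ≃* R, F.IsIso e ∧ ∀ x : Q, (e x : P) = f x := by
  obtain ⟨φ, hφ, h1⟩ := hF.exists_hom h.isMor fun x => h.mapsTo
  obtain ⟨S, hS, ψ, h2, h3, rfl⟩ := F.factor φ hφ
  have h4 : ∀ x : Q, (ψ x : P) = f x := h1
  obtain rfl : S = R := by
    refine le_antisymm hS fun y hy => ?_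
    obtain ⟨x, hx, rfl⟩ := h.exists_eq hy
    rw [← h4 ⟨x, hx⟩]
    exact Subtype.coe_prop _
  exact ⟨ψ, ⟨h2, h3⟩, h4⟩

theorem comp (hF : F.IsSaturatedFusionSystem p) (hf : F.IsMor Q f) (hg : F.IsMor R g)
    (h : ∀ x ∈ Q, f x ∈ R) : F.IsMor Q (g ∘ f) := by
  obtain ⟨φ, hφ, h1⟩ := hF.exists_hom hf h
  obtain ⟨ψ, hψ, h2⟩ := hg
  refine ⟨_, F.comp_mem _ _ hψ hφ, fun x => ?_⟩
  rw [Function.comp_apply, ← h1, h2]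
  rfl

theorem isIsoOn_comp (hF : F.IsSaturatedFusionSystem p) (hf : F.IsIsoOn Q R f)
    (hg : F.IsIsoOn R S g) : F.IsIsoOn Q S (g ∘ f) :=
  ⟨hF.comp hf.isMor hg.isMor fun _ => hf.mapsTo, by rw [Set.image_comp, hf.image_eq, hg.image_eq]⟩

theorem isMor_conj (hF : F.IsSaturatedFusionSystem p) (Q : Subgroup P) (a : P) :
    F.IsMor Q fun x => a * x * a⁻¹ := by
  let φ : Q →* (⊤ : Subgroup P) :=
    { toFun := fun x => ⟨a * x * a⁻¹, trivial⟩
      map_one' := by ext; simp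
      map_mul' := fun x y => by ext; simp [mul_assoc] }
  exact ⟨φ, hF.conj_mem _ _ ⟨a, fun x => rfl⟩, fun x => rfl⟩

theorem isMor_id (hF : F.IsSaturatedFusionSystem p) (Q : Subgroup P) : F.IsMor Q id :=
  (hF.isMor_conj Q 1).congr fun x _ => by simp

theorem mono (hF : F.IsSaturatedFusionSystem p) (hf : F.IsMor R f) (h : Q ≤ R) : F.IsMor Q f :=
  hF.comp (hF.isMor_id Q) hf h

open Classical in
theorem exists_isIsoOn_of_isIso (hF : F.IsSaturatedFusionSystem p) {e : Q ≃* R} (he : F.IsIso e) :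
    ∃ f, F.IsIsoOn Q R f ∧ ∀ x : Q, f x = e x := by
  obtain ⟨f, h⟩ : ∃ f : P → P, ∀ x : Q, f x = e x :=
    ⟨fun x => if hx : x ∈ Q then (e ⟨x, hx⟩ : P) else 1, fun x => by simp⟩
  refine ⟨f, ⟨hF.isMor_of_mem he.1 h, ?_⟩, h⟩
  ext y
  constructor
  · rintro ⟨x, hx, rfl⟩
    rw [h ⟨x, hx⟩]
    exact Subtype.coe_prop _
  · intro hy
    exact ⟨e.symm ⟨y, hy⟩, Subtype.coe_prop _, by rw [h]; simp⟩

theorem exists_symm (hF : F.IsSaturatedFusionSystem p) (h : F.IsIsoOn Q R f) :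
    ∃ g, F.IsIsoOn R Q g ∧ (∀ x ∈ Q, g (f x) = x) ∧ ∀ y ∈ R, f (g y) = y := by
  obtain ⟨e, he, h1⟩ := hF.exists_mulEquiv h
  obtain ⟨g, hg, h2⟩ := hF.exists_isIsoOn_of_isIso (e := e.symm) ⟨he.2, he.1⟩
  refine ⟨g, hg, fun x hx => ?_, fun y hy => ?_⟩
  · rw [← h1 ⟨x, hx⟩, h2]
    simp
  · rw [h2 ⟨y, hy⟩, ← h1]
    simp

theorem exists_isIsoOn_of_mem_aut (hF : F.IsSaturatedFusionSystem p) {α : MulAut Q}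
    (h : α ∈ F.aut Q) : ∃ f, F.IsIsoOn Q Q f ∧ ∀ x : Q, f x = α x :=
  hF.exists_isIsoOn_of_isIso ⟨h, (F.aut Q).inv_mem h⟩

theorem exists_mem_aut (hF : F.IsSaturatedFusionSystem p) (h : F.IsIsoOn Q Q f) :
    ∃ α ∈ F.aut Q, ∀ x : Q, (α x : P) = f x := by
  obtain ⟨e, he, h1⟩ := hF.exists_mulEquiv h
  exact ⟨e, he.1, h1⟩

theorem conjAut_le_aut (hF : F.IsSaturatedFusionSystem p) (Q : Subgroup P) :
    conjAut Q ≤ F.aut Q :=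
  fun _ h => hF.conj_mem _ _ h

theorem card_normalizer_le (hF : F.IsSaturatedFusionSystem p) (hR : F.FullyNormalized R)
    (h : F.IsIsoOn R S f) : Nat.card (Subgroup.normalizer (S : Set P)) ≤
      Nat.card (Subgroup.normalizer (R : Set P)) := by
  obtain ⟨e, he, -⟩ := hF.exists_mulEquiv h
  exact hR S ⟨e, he⟩

theorem exists_fullyNormalized [Finite P] (hF : F.IsSaturatedFusionSystem p) (Q : Subgroup P) :
    ∃ R f, F.IsIsoOn Q R f ∧ F.FullyNormalized R := by
  have : Nonempty {R // ∃ f, F.IsIsoOn Q R f} := ⟨Q, id, hF.isMor_id Q, Set.image_id _⟩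
  obtain ⟨⟨R, f, hf⟩, hR⟩ := Finite.exists_max fun R : {R // ∃ f, F.IsIsoOn Q R f} =>
    Nat.card (Subgroup.normalizer (R.1 : Set P))
  refine ⟨R, f, hf, fun S ⟨e, he⟩ => ?_⟩
  obtain ⟨g, hg, -⟩ := hF.exists_isIsoOn_of_isIso he
  exact hR ⟨S, _, hF.isIsoOn_comp hf hg⟩

/-- The extension axiom: an isomorphism `f : Q → R` onto a fully normalized subgroup extends to
every group `N` of elements that normalize `Q` and act on it as an element of `N_P(R)` acts
on `R`. -/
theorem exists_extension (hF : F.IsSaturatedFusionSystem p) (hf : F.IsIsoOn Q R f)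
    (hR : F.FullyNormalized R) (hN : N ≤ Subgroup.normalizer (Q : Set P))
    (h : ∀ x ∈ N, ∃ y ∈ Subgroup.normalizer (R : Set P),
      ∀ z ∈ Q, f (x * z * x⁻¹) = y * f z * y⁻¹) :
    ∃ g, F.IsMor N g ∧ ∀ z ∈ Q, g z = f z := by
  classical
  obtain ⟨e, he, h1⟩ := hF.exists_mulEquiv hf
  obtain ⟨ψ, hψ, hle, h2⟩ := hF.extension Q R e he hR
  have hrange : (R.subtype.comp e.toMonoidHom).range = R := by
    ext y
    constructor
    · rintro ⟨x, rfl⟩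
      exact Subtype.coe_prop _
    · intro hy
      exact ⟨e.symm ⟨y, hy⟩, by simp⟩
  have hNA : N ≤ extenderSubgroup (R.subtype.comp e.toMonoidHom) := by
    intro x hx
    obtain ⟨y, hy, hxy⟩ := h x hx
    refine ⟨hN hx, y, by rw [hrange]; exact hy, fun z w hw => ?_⟩
    have h3 := hxy z z.2
    rw [← hw, ← h1, ← h1] at h3
    exact h3
  refine ⟨fun x => if hx : x ∈ extenderSubgroup (R.subtype.comp e.toMonoidHom) then ψ ⟨x, hx⟩
    else 1, hF.mono (R := extenderSubgroup (R.subtype.comp e.toMonoidHom)) ⟨ψ, hψ, ?_⟩ hNA, ?_⟩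
  · exact fun x => dif_pos x.2
  · intro z hz
    simp only [dif_pos (hle hz)]
    rw [← h1 ⟨z, hz⟩]
    exact h2 ⟨z, hz⟩

end IsSaturatedFusionSystem

end CategoryOn

end FusionSystems

/-! ### Fully normalized subgroups are fully automized. -/

namespace FusionSystems

namespace CategoryOn

variable {P : Type*} [Group P] {F : CategoryOn P} {p : ℕ} {Q R S N : Subgroup P} {f g : P → P}

theorem IsMor.isIsoOn [Finite P] (h : F.IsMor Q f) (hQ : ∀ x ∈ Q, f x ∈ Q) : F.IsIsoOn Q Q f := by
  refine ⟨h, Set.eq_of_subset_of_ncard_le (Set.image_subset_iff.2 hQ) ?_ (Set.toFinite _)⟩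
  rw [h.injOn.ncard_image]

variable (F p Q) in
/-- `Aut_P(Q)` is a Sylow subgroup of `Aut_F(Q)`. -/
def FullyAutomized : Prop :=
  ∃ S : Sylow p (F.aut Q), (S : Subgroup (F.aut Q)) = (conjAut Q).subgroupOf (F.aut Q)

theorem mem_normalizer_of_conj [Finite P] {y : P} (h : ∀ x ∈ Q, y * x * y⁻¹ ∈ Q) :
    y ∈ Subgroup.normalizer (Q : Set P) :=
  Subgroup.mem_normalizer_fintype h

theorem normalizerMonoidHom_mem_conjAut (x : Subgroup.normalizer (Q : Set P)) :
    Q.normalizerMonoidHom x ∈ conjAut Q :=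
  ⟨x, fun _ => rfl⟩

theorem exists_mem_normalizer_of_mem_conjAut [Finite P] {α : MulAut Q} (h : α ∈ conjAut Q) :
    ∃ y ∈ Subgroup.normalizer (Q : Set P), ∀ z : Q, (α z : P) = y * z * y⁻¹ := by
  obtain ⟨y, hy⟩ := h
  refine ⟨y, mem_normalizer_of_conj fun x hx => ?_, hy⟩
  have := hy ⟨x, hx⟩
  rw [← this]
  exact Subtype.coe_prop _

theorem isPGroup_conjAut (hP : IsPGroup p P) (Q : Subgroup P) : IsPGroup p (conjAut Q) := by
  rintro ⟨α, g, hg⟩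
  obtain ⟨k, hk⟩ := hP g
  have h : ∀ (j : ℕ) (z : Q), ((α ^ j) z : P) = g ^ j * z * (g ^ j)⁻¹ := by
    intro j
    induction j with
    | zero => simp
    | succ j ih =>
      intro z
      have h1 := hg z
      simp only [MulEquiv.toMonoidHom_eq_coe, MonoidHom.coe_coe] at h1
      rw [pow_succ, MulAut.mul_apply, ih, h1, pow_succ]
      group
  refine ⟨k, Subtype.ext (MulEquiv.ext fun z => Subtype.ext ?_)⟩
  rw [Subgroup.coe_pow, h, hk]
  simp

namespace IsSaturatedFusionSystem

/-- A `p`-group of automorphisms of `Q` in `F` is transported, by a suitable isomorphism of `Q` with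
a fully automized subgroup `R`, into `Aut_P(R)`. -/
theorem exists_isIsoOn_conj [Finite P] [Fact p.Prime] (hF : F.IsSaturatedFusionSystem p)
    (hR : F.FullyAutomized p R) (hf : F.IsIsoOn Q R f) {T : Subgroup (MulAut Q)}
    (hT : T ≤ F.aut Q) (hTp : IsPGroup p T) :
    ∃ g, F.IsIsoOn Q R g ∧ ∀ t ∈ T, ∃ y ∈ Subgroup.normalizer (R : Set P),
      ∀ z : Q, g (t z) = y * g z * y⁻¹ := by
  obtain ⟨e, he, h1⟩ := hF.exists_mulEquiv hf
  obtain ⟨S, hS⟩ := hR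
  set T' : Subgroup (F.aut R) := (T.map (MulAut.congr e).toMonoidHom).subgroupOf (F.aut R)
  have hT' : IsPGroup p T' := (hTp.map _).comap_subtype
  obtain ⟨U, hU⟩ := hT'.exists_le_sylow
  have : Finite (MulAut R) := Finite.of_injective (fun a : MulAut R => (a : R → R))
    DFunLike.coe_injective
  -- The transported group lies in a conjugate of `Aut_P(R)`; composing `f` with the inverse of the
  -- conjugating automorphism moves it into `Aut_P(R)` itself.
  obtain ⟨a, rfl⟩ := MulAction.exists_smul_eq (F.aut R) S U
  obtain ⟨b, hb, h2⟩ := hF.exists_isIsoOn_of_mem_aut ((F.aut R).inv_mem a.2)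
  refine ⟨b ∘ f, hF.isIsoOn_comp hf hb, fun t ht => ?_⟩
  have hu : MulAut.congr e t ∈ F.aut R :=
    F.comp_mem _ _ (F.comp_mem e.toMonoidHom t.toMonoidHom he.1 (hT ht)) he.2
  have hu' : (⟨MulAut.congr e t, hu⟩ : F.aut R) ∈ T' := ⟨t, ht, rfl⟩
  have h3 := hU hu'
  rw [Sylow.coe_subgroup_smul] at h3
  have h4 : a⁻¹ * ⟨MulAut.congr e t, hu⟩ * a ∈ (S : Subgroup (F.aut R)) := by
    have h5 := Subgroup.mem_pointwise_smul_iff_inv_smul_mem.1 h3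
    simpa [MulAut.smul_def, ← map_inv] using h5
  rw [hS] at h4
  obtain ⟨y, hy, h5⟩ := exists_mem_normalizer_of_mem_conjAut (Subgroup.mem_subgroupOf.1 h4)
  refine ⟨y, hy, fun z => ?_⟩
  have h6 := h5 ((a : MulAut R)⁻¹ (e z))
  simp only [Subgroup.coe_mul, MulAut.mul_apply, MulAut.apply_inv_self, Subgroup.coe_inv] at h6
  rw [Function.comp_apply, Function.comp_apply, ← h1, ← h1, h2, h2]
  simpa using h6

/-- Once `Aut_P(Q)` has been moved into `Aut_P(R)`, the extension axiom applies to all of `N_P(Q)`.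
-/
theorem exists_isMor_normalizer [Finite P] [Fact p.Prime] (hF : F.IsSaturatedFusionSystem p)
    (hP : IsPGroup p P) (hR : F.FullyNormalized R) (hR' : F.FullyAutomized p R)
    (hf : F.IsIsoOn Q R f) :
    ∃ g, F.IsIsoOn Q R g ∧ F.IsMor (Subgroup.normalizer (Q : Set P)) g := by
  obtain ⟨g, hg, h⟩ := hF.exists_isIsoOn_conj hR' hf (hF.conjAut_le_aut Q) (isPGroup_conjAut hP Q)
  obtain ⟨k, hk, h2⟩ := hF.exists_extension hg hR le_rfl fun x hx => by
    obtain ⟨y, hy, h3⟩ := h _ (normalizerMonoidHom_mem_conjAut ⟨x, hx⟩)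
    exact ⟨y, hy, fun z hz => h3 ⟨z, hz⟩⟩
  exact ⟨k, hg.congr h2, hk⟩

/-- Elements of `p`-power order of `Aut_F(Q)` that normalize `Aut_P(Q)` belong to it. -/
theorem mem_conjAut_of_normalizes [Finite P] [hp : Fact p.Prime]
    (hF : F.IsSaturatedFusionSystem p) (hQ : F.FullyNormalized Q)
    (hQN : Q < Subgroup.normalizer (Q : Set P))
    (ih : ∀ R : Subgroup P, Nat.card Q < Nat.card R → F.FullyNormalized R → F.FullyAutomized p R)
    {φ : MulAut Q} (hφ : φ ∈ F.aut Q) {k : ℕ} (hk : φ ^ p ^ k = 1)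
    (hn : ∀ s ∈ conjAut Q, φ * s * φ⁻¹ ∈ conjAut Q) : φ ∈ conjAut Q := by
  obtain ⟨f, hf, h1⟩ := hF.exists_isIsoOn_of_mem_aut hφ
  set N := Subgroup.normalizer (Q : Set P) with hN
  have hQN' : Q ≤ N := hQN.le
  -- As `φ` normalizes `Aut_P(Q)`, it extends to `N = N_P(Q)`.
  obtain ⟨g, hg, h2⟩ := hF.exists_extension hf hQ (le_refl N) fun x hx => by
    obtain ⟨y, hy, h3⟩ := exists_mem_normalizer_of_mem_conjAut
      (hn _ (normalizerMonoidHom_mem_conjAut ⟨x, hx⟩))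
    refine ⟨y, hy, fun z hz => ?_⟩
    have h4 := h3 (φ ⟨z, hz⟩)
    rw [MulAut.mul_apply, MulAut.mul_apply, MulAut.inv_apply_self, ← h1, ← h1] at h4
    exact h4
  have hgN : ∀ x ∈ N, g x ∈ N := by
    refine fun x hx => mem_normalizer_of_conj fun z hz => ?_
    obtain ⟨w, hw, rfl⟩ := hf.exists_eq hz
    rw [← h2 w hw, ← hg.map_conj hx (hQN' hw)]
    have h3 : x * w * x⁻¹ ∈ Q := (Subgroup.mem_normalizer_iff.1 hx w).1 hw
    rw [h2 _ h3]
    exact hf.mapsTo h3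
  obtain ⟨α, hα, h3⟩ := hF.exists_mem_aut (hg.isIsoOn hgN)
  have hres : ∀ (j : ℕ) (z : Q), ((α ^ j) ⟨z, hQN' z.2⟩ : P) = (φ ^ j) z := by
    intro j
    induction j with
    | zero => simp
    | succ j ih =>
      intro z
      have h4 : α ⟨z, hQN' z.2⟩ = ⟨φ z, hQN' (φ z).2⟩ := by
        apply Subtype.ext
        rw [h3, h2 _ z.2, h1]
      rw [pow_succ, MulAut.mul_apply, h4, ih, pow_succ, MulAut.mul_apply]
  have : Finite (MulAut N) := Finite.of_injective (fun a : MulAut N => (a : N → N))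
    DFunLike.coe_injective
  -- The extension `α` need not have `p`-power order, but `α ^ m` does, where `m` is the part of its
  -- order prime to `p`.
  obtain ⟨a, m, hm, ham⟩ := Nat.exists_eq_pow_mul_and_not_dvd (orderOf_pos α).ne' p hp.1.ne_one
  have hβ : IsPGroup p (Subgroup.zpowers (α ^ m)) := by
    rintro ⟨_, i, rfl⟩
    refine ⟨a, Subtype.ext ?_⟩
    change ((α ^ m) ^ i) ^ p ^ a = 1
    rw [← zpow_natCast, zpow_comm, zpow_natCast, ← pow_mul, mul_comm, ← ham, pow_orderOf_eq_one,
      one_zpow]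
  have hβF : Subgroup.zpowers (α ^ m) ≤ F.aut N := by
    rw [Subgroup.zpowers_le]
    exact pow_mem hα m
  obtain ⟨N', τ₀, hτ₀, hN'⟩ := hF.exists_fullyNormalized N
  have hcard : Nat.card Q < Nat.card N' := by
    rw [← hτ₀.card_eq]
    exact Set.ncard_lt_ncard hQN (Set.toFinite _)
  obtain ⟨τ, hτ, h4⟩ := hF.exists_isIsoOn_conj (ih N' hcard hN') hτ₀ hβF hβ
  obtain ⟨y, hy, h5⟩ := h4 _ (Subgroup.mem_zpowers _)
  obtain ⟨Q₁, hQ₁⟩ := (hF.mono hτ.isMor hQN').exists_isIsoOn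
  have h6 : ∀ z : Q, τ ((φ ^ m) z) = y * τ z * y⁻¹ := by
    intro z
    rw [← hres]
    exact h5 ⟨z, hQN' z.2⟩
  have hyQ₁ : y ∈ Subgroup.normalizer (Q₁ : Set P) := by
    refine mem_normalizer_of_conj fun x hx => ?_
    obtain ⟨z, hz, rfl⟩ := hQ₁.exists_eq hx
    rw [← h6 ⟨z, hz⟩]
    exact hQ₁.mapsTo (Subtype.coe_prop _)
  have hle : N' ≤ Subgroup.normalizer (Q₁ : Set P) := by
    intro n hn
    obtain ⟨x, hx, rfl⟩ := hτ.exists_eq hn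
    refine mem_normalizer_of_conj fun w hw => ?_
    obtain ⟨z, hz, rfl⟩ := hQ₁.exists_eq hw
    rw [← hτ.isMor.map_conj hx (hQN' hz)]
    exact hQ₁.mapsTo ((Subgroup.mem_normalizer_iff.1 hx z).1 hz)
  -- Full normalization of `Q` bounds `|N_P(Q₁)|` by `|N_P(Q)| = |N'|`. Hence `y` lies in `N' =
  -- τ(N)` and pulls back to an element of `N` inducing `φ ^ m`.
  have heq : N' = Subgroup.normalizer (Q₁ : Set P) := by
    refine Subgroup.eq_of_le_of_card_ge hle ?_
    rw [← hτ.card_eq]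
    exact hF.card_normalizer_le hQ hQ₁
  rw [← heq] at hyQ₁
  obtain ⟨x, hx, rfl⟩ := hτ.exists_eq hyQ₁
  have h7 : φ ^ m ∈ conjAut Q := by
    refine ⟨x, fun z => hτ.isMor.injOn (hQN' (Subtype.coe_prop _)) ?_ ?_⟩
    · exact mul_mem (mul_mem hx (hQN' z.2)) (inv_mem hx)
    · rw [hτ.isMor.map_conj hx (hQN' z.2)]
      exact h6 z
  -- Since `φ` has `p`-power order, it is a power of `φ ^ m`.
  have hcop : m.Coprime (orderOf φ) :=
    Nat.Coprime.coprime_dvd_right (orderOf_dvd_of_pow_eq_one hk)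
      (((Nat.Prime.coprime_iff_not_dvd hp.1).2 hm).symm.pow_right k)
  obtain ⟨j, hj⟩ := exists_pow_eq_self_of_coprime hcop
  rw [← hj]
  exact pow_mem h7 j

/-- If `Aut_P(Q)` were properly contained in a Sylow subgroup `T`, its normalizer in the nilpotent
group `T` would be larger, against `mem_conjAut_of_normalizes`. The induction is on `|P| - |Q|`,
starting from the Sylow axiom for `P`. -/
theorem fullyAutomized [Finite P] [hp : Fact p.Prime] (hF : F.IsSaturatedFusionSystem p)
    (hP : IsPGroup p P) (hQ : F.FullyNormalized Q) : F.FullyAutomized p Q := by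
  induction hd : Nat.card P - Nat.card Q using Nat.strong_induction_on generalizing Q with
  | _ d ih =>
  obtain rfl | hQt := eq_or_ne Q ⊤
  · exact hF.sylow
  have : Group.IsNilpotent P := hP.isNilpotent
  have hQN := Group.normalizerCondition_of_isNilpotent Q (lt_top_iff_ne_top.2 hQt)
  have ih' : ∀ R : Subgroup P, Nat.card Q < Nat.card R → F.FullyNormalized R →
      F.FullyAutomized p R := by
    intro R hR hRn
    refine ih _ ?_ hRn rfl
    have := Subgroup.card_le_card_group R
    omega
  have : Finite (MulAut Q) := Finite.of_injective (fun a : MulAut Q => (a : Q → Q))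
    DFunLike.coe_injective
  set S := (conjAut Q).subgroupOf (F.aut Q) with hS
  have hSp : IsPGroup p S := (isPGroup_conjAut hP Q).comap_subtype
  obtain ⟨T, hT⟩ := hSp.exists_le_sylow
  refine ⟨T, le_antisymm ?_ hT⟩
  by_contra hTS
  have : Group.IsNilpotent T := T.2.isNilpotent
  have hlt : S.subgroupOf T < ⊤ := by
    rw [lt_top_iff_ne_top, Ne, Subgroup.subgroupOf_eq_top]
    exact hTS
  obtain ⟨t, ht, htS⟩ := SetLike.exists_of_lt (Group.normalizerCondition_of_isNilpotent _ hlt)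
  refine htS ?_
  obtain ⟨k, hk⟩ := T.2 t
  have hk' := congrArg (fun s : T => ((s : F.aut Q) : MulAut Q)) hk
  refine hF.mem_conjAut_of_normalizes (k := k) hQ hQN ih' t.1.2 (by simpa using hk') ?_
  intro s hs
  have hsT : (⟨s, hF.conjAut_le_aut Q hs⟩ : F.aut Q) ∈ (T : Subgroup (F.aut Q)) := hT hs
  exact (Subgroup.mem_normalizer_iff.1 ht ⟨_, hsT⟩).1 hs

end IsSaturatedFusionSystem

end CategoryOn

end FusionSystems

/-! ### The Frattini argument and powers of central elements. -/

theorem Sylow.exists_coe_eq_subgroupOf {G : Type*} [Group G] [Finite G] {p : ℕ} [Fact p.Prime]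
    (S : Sylow p G) (M : Subgroup G) [M.Normal] :
    ∃ T : Sylow p M, (T : Subgroup M) = (S : Subgroup G).subgroupOf M := by
  have hS : IsPGroup p ((S : Subgroup G).subgroupOf M) := S.2.comap_subtype
  obtain ⟨T, hT⟩ := hS.exists_le_sylow
  refine ⟨T, (Subgroup.eq_of_le_of_card_ge hT ?_).symm⟩
  obtain ⟨U, hU⟩ := (T.2.map M.subtype).exists_le_sylow
  obtain ⟨a, rfl⟩ := MulAction.exists_smul_eq G S U
  have h : ∀ t : T, a⁻¹ * ((t : M) : G) * a ∈ (S : Subgroup G) := by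
    intro t
    have h1 := hU (Subgroup.mem_map_of_mem M.subtype t.2)
    rw [Sylow.coe_subgroup_smul] at h1
    have h2 := Subgroup.mem_pointwise_smul_iff_inv_smul_mem.1 h1
    simpa [MulAut.smul_def, ← map_inv] using h2
  have hM : ∀ t : T, a⁻¹ * ((t : M) : G) * a ∈ M := by
    intro t
    simpa using Subgroup.Normal.conj_mem ‹M.Normal› _ (t : M).2 a⁻¹
  refine Nat.card_le_card_of_injective
    (fun t : T => (⟨⟨_, hM t⟩, h t⟩ : (S : Subgroup G).subgroupOf M)) ?_
  intro s t hst
  have h3 := congrArg (fun u : (S : Subgroup G).subgroupOf M => ((u : M) : G)) hst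
  simpa using h3

/-- The Frattini argument, as `S ⊓ M` is a Sylow subgroup of `M`. -/
theorem Sylow.normalizer_inf_sup_eq_top {G : Type*} [Group G] [Finite G] {p : ℕ} [Fact p.Prime]
    (S : Sylow p G) (M : Subgroup G) [M.Normal] :
    Subgroup.normalizer (((S : Subgroup G) ⊓ M : Subgroup G) : Set G) ⊔ M = ⊤ := by
  obtain ⟨T, hT⟩ := S.exists_coe_eq_subgroupOf M
  rw [← T.normalizer_sup_eq_top, hT, Subgroup.subgroupOf_map_subtype]

/-- The `m`-th powers of central elements. -/
def Subgroup.centerPow (G : Type*) [Group G] (m : ℕ) : Subgroup G where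
  carrier := {w | ∃ z ∈ Subgroup.center G, z ^ m = w}
  one_mem' := ⟨1, one_mem _, one_pow m⟩
  mul_mem' := by
    rintro _ _ ⟨a, ha, rfl⟩ ⟨b, hb, rfl⟩
    exact ⟨a * b, mul_mem ha hb, Commute.mul_pow (Subgroup.mem_center_iff.1 hb a) m⟩
  inv_mem' := by
    rintro _ ⟨a, ha, rfl⟩
    exact ⟨a⁻¹, inv_mem ha, inv_pow a m⟩

theorem Subgroup.centerPow_le_center (G : Type*) [Group G] (m : ℕ) :
    Subgroup.centerPow G m ≤ Subgroup.center G := by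
  rintro _ ⟨a, ha, rfl⟩
  exact pow_mem ha m

instance Subgroup.normal_centerPow (G : Type*) [Group G] (m : ℕ) :
    (Subgroup.centerPow G m).Normal :=
  ⟨fun w hw g => by
    rw [Subgroup.mem_center_iff.1 (Subgroup.centerPow_le_center G m hw) g, mul_inv_cancel_right]
    exact hw⟩

/-! ### Extensions of morphisms that preserve `W`. -/

namespace FusionSystems

namespace CategoryOn

variable {P : Type*} [Group P] {F : CategoryOn P} {p : ℕ} {Q R S N W : Subgroup P} {f g : P → P}

variable (F) in
/-- `f` extends to a morphism `W Q → P` of `F` that maps `W` into itself. -/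
def ExtendsPreserving (W Q : Subgroup P) (f : P → P) : Prop :=
  ∃ g, F.IsMor (W ⊔ Q) g ∧ (∀ x ∈ Q, g x = f x) ∧ ∀ w ∈ W, g w ∈ W

theorem IsMor.map_mem_sup (h : F.IsMor (W ⊔ Q) f) [W.Normal] (hW : ∀ w ∈ W, f w ∈ W)
    (hQ : ∀ x ∈ Q, f x ∈ R) : ∀ x ∈ W ⊔ Q, f x ∈ W ⊔ R := by
  intro x hx
  have hx' : x ∈ ((W ⊔ Q : Subgroup P) : Set P) := hx
  rw [Subgroup.normal_mul] at hx'
  obtain ⟨w, hw, q, hq, rfl⟩ := hx'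
  rw [h.map_mul (Subgroup.mem_sup_left hw) (Subgroup.mem_sup_right hq)]
  exact mul_mem (Subgroup.mem_sup_left (hW w hw)) (Subgroup.mem_sup_right (hQ q hq))

namespace ExtendsPreserving

theorem restrict (hF : F.IsSaturatedFusionSystem p) (h : F.ExtendsPreserving W R g) (hQ : Q ≤ R)
    (hfg : ∀ x ∈ Q, g x = f x) : F.ExtendsPreserving W Q f := by
  obtain ⟨k, hk, h1, h2⟩ := h
  exact ⟨k, hF.mono hk (sup_le_sup_left hQ W), fun x hx => (h1 x (hQ hx)).trans (hfg x hx), h2⟩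

theorem comp [W.Normal] (hF : F.IsSaturatedFusionSystem p) (hf : F.ExtendsPreserving W Q f)
    (hg : F.ExtendsPreserving W R g) (h : ∀ x ∈ Q, f x ∈ R) :
    F.ExtendsPreserving W Q (g ∘ f) := by
  obtain ⟨k, hk, h1, h2⟩ := hf
  obtain ⟨l, hl, h3, h4⟩ := hg
  refine ⟨l ∘ k, hF.comp hk hl (hk.map_mem_sup h2 fun x hx => ?_), fun x hx => ?_,
    fun w hw => h4 _ (h2 w hw)⟩
  · rw [h1 x hx]
    exact h x hx
  · rw [Function.comp_apply, h1 x hx, h3 _ (h x hx), Function.comp_apply]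

theorem symm [Finite P] (hF : F.IsSaturatedFusionSystem p) (hf : F.ExtendsPreserving W Q f)
    (h : F.IsIsoOn Q R f) (hgf : ∀ x ∈ Q, g (f x) = x) : F.ExtendsPreserving W R g := by
  obtain ⟨k, hk, h1, h2⟩ := hf
  obtain ⟨X, hX⟩ := hk.exists_isIsoOn
  obtain ⟨l, hl, h3, -⟩ := hF.exists_symm hX
  have hW := (hF.mono hk le_sup_left).isIsoOn h2
  have hWX : W ≤ X := by
    intro w hw
    obtain ⟨v, hv, rfl⟩ := hW.exists_eq hw
    exact hX.mapsTo (Subgroup.mem_sup_left hv)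
  have hRX : R ≤ X := by
    intro y hy
    obtain ⟨x, hx, rfl⟩ := h.exists_eq hy
    rw [← h1 x hx]
    exact hX.mapsTo (Subgroup.mem_sup_right hx)
  refine ⟨l, hF.mono hl.isMor (sup_le hWX hRX), fun y hy => ?_, fun w hw => ?_⟩
  · obtain ⟨x, hx, rfl⟩ := h.exists_eq hy
    rw [hgf x hx, ← h1 x hx, h3 x (Subgroup.mem_sup_right hx)]
  · obtain ⟨v, hv, rfl⟩ := hW.exists_eq hw
    rwa [h3 v (Subgroup.mem_sup_left hv)]

end ExtendsPreserving

/-- By finiteness `f` is an automorphism of `P`, and the group of `m`-th powers of central elements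
is characteristic. -/
theorem extendsPreserving_centerPow_top [Finite P] {m : ℕ} (hf : F.IsMor ⊤ f) :
    F.ExtendsPreserving (Subgroup.centerPow P m) ⊤ f := by
  have h := hf.isIsoOn fun _ _ => Subgroup.mem_top _
  refine ⟨f, by rwa [sup_top_eq], fun _ _ => rfl, ?_⟩
  rintro _ ⟨z, hz, rfl⟩
  refine ⟨f z, Subgroup.mem_center_iff.2 fun y => ?_, (hf.map_pow trivial m).symm⟩
  obtain ⟨x, -, rfl⟩ := h.exists_eq (Subgroup.mem_top y)
  rw [← hf.map_mul trivial trivial, ← hf.map_mul trivial trivial, Subgroup.mem_center_iff.1 hz]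

variable (F Q) in
/-- The automorphisms of `Q` in `F` that centralize the `m`-th powers of elements of `Z(Q)`. -/
def fixingCenterPow (m : ℕ) : Subgroup (F.aut Q) where
  carrier := {α | ∀ v ∈ Subgroup.center Q, (α : MulAut Q) (v ^ m) = v ^ m}
  one_mem' := fun _ _ => rfl
  mul_mem' := fun {a b} ha hb v hv => by
    rw [Subgroup.coe_mul, MulAut.mul_apply, hb v hv, ha v hv]
  inv_mem' := fun {a} ha v hv => by
    rw [Subgroup.coe_inv, ← ha v hv, MulAut.inv_apply_self, ha v hv]

instance normal_fixingCenterPow (m : ℕ) : (F.fixingCenterPow Q m).Normal := by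
  refine ⟨fun a ha g v hv => ?_⟩
  have hv' : (g : MulAut Q)⁻¹ v ∈ Subgroup.center Q := by
    rw [Subgroup.mem_center_iff] at hv ⊢
    intro y
    apply (g : MulAut Q).injective
    rw [map_mul, map_mul, MulAut.apply_inv_self, hv]
  rw [Subgroup.coe_mul, Subgroup.coe_mul, Subgroup.coe_inv, MulAut.mul_apply, MulAut.mul_apply,
    map_pow, ha _ hv', ← map_pow, MulAut.apply_inv_self]

namespace IsSaturatedFusionSystem

/-- An element `q z` with `q` in `Q` and `z` central acts on `Q` as `q`, so `f` extends to the
larger group `Q Z(P)`. -/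
theorem extendsPreserving_of_not_center_le [Finite P] (hF : F.IsSaturatedFusionSystem p)
    (hQ : F.FullyNormalized Q) (hf : F.IsIsoOn Q Q f) (hZ : ¬ Subgroup.center P ≤ Q)
    (ih : ∀ (A : Subgroup P) (g : P → P), Nat.card Q < Nat.card A → F.IsMor A g →
      F.ExtendsPreserving W A g) : F.ExtendsPreserving W Q f := by
  have hlt : Q < Q ⊔ Subgroup.center P :=
    lt_of_le_of_ne le_sup_left fun h => hZ (by rw [h]; exact le_sup_right)
  obtain ⟨g, hg, h1⟩ := hF.exists_extension (N := Q ⊔ Subgroup.center P) hf hQ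
    (sup_le Subgroup.le_normalizer (Subgroup.center_le_normalizer _)) fun x hx => by
      have hx' : x ∈ ((Q ⊔ Subgroup.center P : Subgroup P) : Set P) := hx
      rw [Subgroup.mul_normal] at hx'
      obtain ⟨q, hq, z, hz, rfl⟩ := hx'
      refine ⟨f q, Subgroup.le_normalizer (hf.mapsTo hq), fun w hw => ?_⟩
      have h2 : q * z * w * (q * z)⁻¹ = q * w * q⁻¹ := by
        rw [mul_assoc q z w, ← Subgroup.mem_center_iff.1 hz w]
        group
      rw [← hf.isMor.map_conj hq hw]
      exact congrArg f h2
  exact (ih _ g (Set.ncard_lt_ncard hlt (Set.toFinite _)) hg).restrict hF hlt.le h1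

theorem extendsPreserving_of_center_le [Finite P] [hp : Fact p.Prime]
    (hF : F.IsSaturatedFusionSystem p) (hP : IsPGroup p P) {n : ℕ}
    (hc : Group.nilpotencyClass P ≤ n * (p - 1) + 1)
    (hQ : F.FullyNormalized Q) (hQt : Q ≠ ⊤) (hf : F.IsIsoOn Q Q f)
    (hZ : Subgroup.center P ≤ Q)
    (ih : ∀ (A : Subgroup P) (g : P → P), Nat.card Q < Nat.card A → F.IsMor A g →
      F.ExtendsPreserving (Subgroup.centerPow P (p ^ n)) A g) :
    F.ExtendsPreserving (Subgroup.centerPow P (p ^ n)) Q f := by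
  have : Group.IsNilpotent P := hP.isNilpotent
  have : Finite (MulAut Q) := Finite.of_injective (fun a : MulAut Q => (a : Q → Q))
    DFunLike.coe_injective
  have hQN := Group.normalizerCondition_of_isNilpotent Q (lt_top_iff_ne_top.2 hQt)
  have hWQ : Subgroup.centerPow P (p ^ n) ≤ Q := (Subgroup.centerPow_le_center _ _).trans hZ
  obtain ⟨S, hS⟩ := hF.fullyAutomized hP hQ
  obtain ⟨α, hα, hαf⟩ := hF.exists_mem_aut hf
  have hmem : (⟨α, hα⟩ : F.aut Q) ∈ Subgroup.normalizer
      (((S : Subgroup (F.aut Q)) ⊓ F.fixingCenterPow Q (p ^ n) : Subgroup (F.aut Q)) :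
        Set (F.aut Q)) ⊔ F.fixingCenterPow Q (p ^ n) := by
    rw [S.normalizer_inf_sup_eq_top]
    trivial
  rw [← SetLike.mem_coe, Subgroup.mul_normal] at hmem
  -- The Frattini factorization: `β` normalizes `Aut_P(Q) ∩ M` and `μ` lies in `M`, where `M` is
  -- `fixingCenterPow`.
  obtain ⟨β, hβ, μ, hμ, hβμ⟩ := hmem
  obtain ⟨b, hb, hbβ⟩ := hF.exists_isIsoOn_of_mem_aut β.2
  let ρ : Subgroup.normalizer (Q : Set P) →* F.aut Q :=
    Q.normalizerMonoidHom.codRestrict (F.aut Q) fun x =>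
      hF.conjAut_le_aut Q (normalizerMonoidHom_mem_conjAut x)
  set A : Subgroup P :=
    ((F.fixingCenterPow Q (p ^ n)).comap ρ).map (Subgroup.subtype _) with hA
  have hAN : A ≤ Subgroup.normalizer (Q : Set P) := Subgroup.map_subtype_le _
  have hQA : Q < A := by
    have hle : Q ≤ A := by
      refine fun q hq => ⟨⟨q, Subgroup.le_normalizer hq⟩, fun v hv => ?_, rfl⟩
      have h1 := Subgroup.mem_center_iff.1 (pow_mem hv (p ^ n)) ⟨q, hq⟩
      apply Subtype.ext
      change q * ((v ^ p ^ n : Q) : P) * q⁻¹ = _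
      rw [mul_inv_eq_iff_eq_mul]
      exact congrArg Subtype.val h1
    obtain ⟨x, hx, hxQ, hxp⟩ := exists_mem_normalizer_pow_mem hP hQN
    refine lt_of_le_of_ne hle fun h => hxQ ?_
    rw [h]
    refine ⟨⟨x, hx⟩, fun v hv => ?_, rfl⟩
    apply Subtype.ext
    change x * ((v ^ p ^ n : Q) : P) * x⁻¹ = ((v ^ p ^ n : Q) : P)
    rw [Subgroup.coe_pow]
    -- Here `V = Z(Q)`: it is characteristic in `Q`, hence normalized by `x`, and it is centralized
    -- by `x ^ p`, which lies in `Q`.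
    refine conj_pow_eq_of_nilpotencyClass_le hp.1 hc ((Subgroup.center Q).map Q.subtype) ?_ ?_
      (Subgroup.mem_map_of_mem Q.subtype hv)
    · rintro _ ⟨u, hu, rfl⟩
      have hu' : Q.normalizerMonoidHom ⟨x, hx⟩ u ∈ Subgroup.center Q := by
        have := Subgroup.centerCharacteristic (G := Q)
        exact Subgroup.mem_comap.1 ((this.fixed (Q.normalizerMonoidHom ⟨x, hx⟩)).symm ▸ hu)
      exact ⟨_, hu', rfl⟩
    · rintro _ ⟨u, hu, rfl⟩
      have h1 := congrArg Subtype.val (Subgroup.mem_center_iff.1 hu ⟨x ^ p, hxp⟩)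
      rw [mul_inv_eq_iff_eq_mul]
      exact h1
  obtain ⟨g, hg, hgb⟩ := hF.exists_extension hb hQ hAN fun x hx => by
    obtain ⟨x, hx, rfl⟩ := hx
    have h1 : ρ x ∈ (S : Subgroup (F.aut Q)) ⊓ F.fixingCenterPow Q (p ^ n) := by
      refine ⟨?_, hx⟩
      change ρ x ∈ (S : Subgroup (F.aut Q))
      rw [hS]
      exact normalizerMonoidHom_mem_conjAut x
    have h2 := ((Subgroup.mem_normalizer_iff.1 hβ _).1 h1).1
    change β * ρ x * β⁻¹ ∈ (S : Subgroup (F.aut Q)) at h2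
    rw [hS] at h2
    obtain ⟨y, hy, h3⟩ := exists_mem_normalizer_of_mem_conjAut (Subgroup.mem_subgroupOf.1 h2)
    refine ⟨y, hy, fun z hz => ?_⟩
    have h4 := h3 ((β : MulAut Q) ⟨z, hz⟩)
    rw [Subgroup.coe_mul, Subgroup.coe_mul, Subgroup.coe_inv, MulAut.mul_apply,
      MulAut.mul_apply, MulAut.inv_apply_self, ← hbβ, ← hbβ] at h4
    exact h4
  obtain ⟨k, hk, hkb, hkW⟩ := (ih A g (Set.ncard_lt_ncard hQA (Set.toFinite _)) hg).restrict hF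
    hQA.le hgb
  -- As `W ≤ Z(P) ≤ Q`, nothing has to be extended: only `f(W) ≤ W` is at stake.
  refine ⟨f, by rw [sup_eq_right.2 hWQ]; exact hf.isMor, fun _ _ => rfl, fun w hw => ?_⟩
  have h1 := hkW w hw
  rw [hkb w (hWQ hw)] at h1
  -- It remains to see that `f` and `b` agree at `w`: `w` is a `p ^ n`-th power of an element of
  -- `Z(Q)`, so `μ` fixes it.
  convert h1 using 1
  obtain ⟨z, hz, rfl⟩ := hw
  have hz' : (⟨z, hZ hz⟩ : Q) ∈ Subgroup.center Q :=
    Subgroup.mem_center_iff.2 fun y => Subtype.ext (Subgroup.mem_center_iff.1 hz y)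
  have h2 := hμ _ hz'
  have h3 : (α : MulAut Q) = (β : MulAut Q) * (μ : MulAut Q) := congrArg Subtype.val hβμ.symm
  have h4 := hαf (⟨z, hZ hz⟩ ^ p ^ n)
  have h5 := hbβ (⟨z, hZ hz⟩ ^ p ^ n)
  rw [h3, MulAut.mul_apply, h2, ← h5] at h4
  exact h4.symm

theorem extendsPreserving_centerPow [Finite P] [hp : Fact p.Prime]
    (hF : F.IsSaturatedFusionSystem p) (hP : IsPGroup p P) {n : ℕ}
    (hc : Group.nilpotencyClass P ≤ n * (p - 1) + 1) (hf : F.IsMor Q f) :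
    F.ExtendsPreserving (Subgroup.centerPow P (p ^ n)) Q f := by
  induction hd : Nat.card P - Nat.card Q using Nat.strong_induction_on generalizing Q f with
  | _ d ih =>
  obtain rfl | hQt := eq_or_ne Q ⊤
  · exact extendsPreserving_centerPow_top hf
  have ih' : ∀ (A : Subgroup P) (g : P → P), Nat.card Q < Nat.card A → F.IsMor A g →
      F.ExtendsPreserving (Subgroup.centerPow P (p ^ n)) A g := by
    intro A g hA hg
    refine ih _ ?_ hg rfl
    have := Subgroup.card_le_card_group A
    omega
  have : Group.IsNilpotent P := hP.isNilpotent
  have hne : ∀ {R : Subgroup P}, Nat.card Q = Nat.card R → R ≠ ⊤ := by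
    rintro _ h rfl
    exact hQt (Subgroup.eq_top_of_card_eq _ (h.trans Subgroup.card_top))
  obtain ⟨Q', τ, hτ, hQ'⟩ := hF.exists_fullyNormalized Q
  have hauto := hF.fullyAutomized hP hQ'
  -- Each conjugate `R` of `Q` has an isomorphism onto `Q'` that extends to `N_P(R) > R`, where the
  -- induction hypothesis applies.
  have hgood : ∀ {R : Subgroup P} {t : P → P}, Nat.card Q = Nat.card R → F.IsIsoOn R Q' t →
      ∃ c, F.IsIsoOn R Q' c ∧ F.ExtendsPreserving (Subgroup.centerPow P (p ^ n)) R c := by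
    intro R t hR ht
    obtain ⟨c, hc1, hc2⟩ := hF.exists_isMor_normalizer hP hQ' hauto ht
    have hRN := Group.normalizerCondition_of_isNilpotent R (lt_top_iff_ne_top.2 (hne hR))
    refine ⟨c, hc1, (ih' _ c ?_ hc2).restrict hF hRN.le fun _ _ => rfl⟩
    rw [hR]
    exact Set.ncard_lt_ncard hRN (Set.toFinite _)
  obtain ⟨R, hR⟩ := hf.exists_isIsoOn
  obtain ⟨f', hf', -⟩ := hF.exists_symm hR
  obtain ⟨c, hc1, hc2⟩ := hgood rfl hτ
  obtain ⟨d, hd1, hd2⟩ := hgood hR.card_eq (hF.isIsoOn_comp hf' hτ)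
  obtain ⟨c', hc', hcc', -⟩ := hF.exists_symm hc1
  obtain ⟨d', hd', hdd', -⟩ := hF.exists_symm hd1
  have hiso : F.IsIsoOn Q' Q' (d ∘ f ∘ c') := hF.isIsoOn_comp (hF.isIsoOn_comp hc' hR) hd1
  have hmid : F.ExtendsPreserving (Subgroup.centerPow P (p ^ n)) Q' (d ∘ f ∘ c') := by
    rw [hτ.card_eq] at ih'
    by_cases hZ : Subgroup.center P ≤ Q'
    · exact hF.extendsPreserving_of_center_le hP hc hQ' (hne hτ.card_eq) hiso hZ ih'
    · exact hF.extendsPreserving_of_not_center_le hQ' hiso hZ ih'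
  -- On `Q`, `f` is `d⁻¹ ∘ (d ∘ f ∘ c⁻¹) ∘ c`, whose middle factor is an automorphism of `Q'`.
  refine (((hc2.comp hF hmid fun _ => hc1.mapsTo).comp hF (hd2.symm hF hd1 hdd') fun x hx =>
    hiso.mapsTo (hc1.mapsTo hx))).restrict hF le_rfl fun x hx => ?_
  simp only [Function.comp_apply]
  rw [hcc' x hx, hdd' _ (hR.mapsTo hx)]

theorem isNormal_of_extendsPreserving [Finite P] [W.Normal] (hF : F.IsSaturatedFusionSystem p)
    (h : ∀ (Q : Subgroup P) (f : P → P), F.IsMor Q f → F.ExtendsPreserving W Q f) :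
    F.IsNormal W := by
  classical
  refine ⟨Subgroup.normalizer_eq_top_iff.2 inferInstance, fun R₁ R₂ => ?_⟩
  refine Set.Subset.antisymm (fun φ h => h.1) fun φ hφ => ⟨hφ, ?_⟩
  obtain ⟨f, hf⟩ : ∃ f : P → P, ∀ x : R₁, f x = φ x :=
    ⟨fun x => if hx : x ∈ R₁ then (φ ⟨x, hx⟩ : P) else 1, fun x => by simp⟩
  obtain ⟨g, hg, hgf, hgW⟩ := h R₁ f (hF.isMor_of_mem hφ hf)
  have hmaps : ∀ x ∈ W ⊔ R₁, g x ∈ W ⊔ R₂ := hg.map_mem_sup hgW fun x hx => by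
    rw [hgf x hx, hf ⟨x, hx⟩]
    exact Subtype.coe_prop _
  obtain ⟨ψ, hψ, hψg⟩ := hF.exists_hom hg hmaps
  refine ⟨ψ, hψ, ⟨le_sup_right, fun z => ?_⟩, ?_⟩
  · rw [hψg, ← hf, ← hgf z z.2]
    rfl
  · ext y
    constructor
    · rintro ⟨x, hx, rfl⟩
      rw [Subgroup.mem_subgroupOf, hψg]
      exact hgW _ hx
    · intro hy
      obtain ⟨x, hx, hxy⟩ := ((hF.mono hg le_sup_left).isIsoOn hgW).exists_eq
        (Subgroup.mem_subgroupOf.1 hy)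
      exact ⟨⟨x, Subgroup.mem_sup_left hx⟩, hx, Subtype.ext ((hψg _).trans hxy)⟩

end IsSaturatedFusionSystem

end CategoryOn

end FusionSystems

/-! ### The exponent bound. -/

theorem mainTheorem6 (p : ℕ) [Fact p.Prime] (n : ℕ) (P : Type*) [Group P] [Finite P]
    (hP : IsPGroup p P) (hclass : Group.nilpotencyClass P ≤ n * (p - 1) + 1)
    (F : FusionSystems.CategoryOn P) (hF : F.IsSaturatedFusionSystem p) (hcore : F.core = ⊥) :
    Monoid.exponent P ≤ p ^ (n ^ 2 * (p - 1) + n) := by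
  have : Group.IsNilpotent P := hP.isNilpotent
  have hp : p.Prime := Fact.out
  have hW : F.IsNormal (Subgroup.centerPow P (p ^ n)) :=
    hF.isNormal_of_extendsPreserving fun _ _ hf => hF.extendsPreserving_centerPow hP hclass hf
  have hle : Subgroup.centerPow P (p ^ n) ≤ F.core := le_sSup hW
  rw [hcore, le_bot_iff] at hle
  have hz : ∀ z ∈ Subgroup.center P, z ^ p ^ n = 1 := by
    intro z hz
    have h : z ^ p ^ n ∈ Subgroup.centerPow P (p ^ n) := ⟨z, hz, rfl⟩
    rwa [hle, Subgroup.mem_bot] at h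
  have hexp : p ^ (n ^ 2 * (p - 1) + n) = (p ^ n) ^ (n * (p - 1) + 1) := by
    rw [← pow_mul]
    congr 1
    ring
  rw [hexp]
  exact Nat.le_of_dvd (pow_pos (pow_pos hp.pos n) _) (exponent_dvd_of_center hz hclass)
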